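/- Let $(X,d)$ be a compact metric space without isolated points and let $N\ge 2$. A map $f:X\to X$ is an infinitesimal similitude if for every $x\in X$ the limit $$(Df)(x)=\lim_{m\to\infty}\frac{d(f(x_m),f(y_m))}{d(x_m,y_m)}$$ exists for all sequences $x_m\to x$, $y_m\to x$ with $x_m\neq y_m$ for all $m$, and does not depend on these sequences. Let $f_1,\dots,f_N:X\to X$ be contractions (each with a Lipschitz constant $<1$) that are infinitesimal similitudes and for which each function $x\mapsto (Df_i)(x)$ is strictly positive and Hölder continuous. For a nonempty word $w=w_1\cdots w_n$ over $\{1,\dots,N\}$ put $f_w=f_{w_1}\circ\cdots\circ f_{w_n}$, and assume that there is a constant $C>0$ such that $$C^{-1}(Df_w)(x)\,d(x,y)\le d(f_w(x),f_w(y))\le C\,(Df_w)(x)\,d(x,y)$$ for all nonempty words $w$ and all $x,y\in X$. Let $(p_1,\dots,p_N)$ be a probability vector and let $\mu$ be the invariant measure, i.e. the Borel probability measure on $X$ with $\mu=\sum_{i=1}^N p_i\,\mu\circ f_i^{-1}$. Let $0<r<\infty$. For $\sigma\ge 0$ let $L_{\sigma,r}$ be the bounded operator on the space $\mathcal C(X)$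 of continuous functions given by $$(L_{\sigma,r}\Phi)(x)=\sum_{i=1}^N\big(p_i\,(Df_i)(x)^r\big)^{\frac{\sigma}{r+\sigma}}\,\Phi(f_i(x))$$ (with $0^0=1$), and let $\sigma_r\ge 0$ be the number for which the spectral radius of $L_{\sigma_r,r}$ equals $1$. For $n\ge 1$ let $$V_{n,r}(\mu)=\inf\Big\{\int d(x,A)^r\,d\mu(x):A\subset X,\ \operatorname{Card}(A)\le n\Big\},\qquad e_{n,r}(\mu)=V_{n,r}(\mu)^{1/r}.$$ Then the $\sigma_r$-dimensional upper quantization coefficient of order $r$ of $\mu$ is finite, $$\limsup_{n\to\infty}\,n\,e_{n,r}(\mu)^{\sigma_r}<\infty,$$ and consequently the upper quantization dimension of order $r$ of $\mu$ satisfies $$\overline D_r(\mu)=\limsup_{n\to\infty}\frac{r\log n}{-\log V_{n,r}(\mu)}\le\sigma_r$$ (where the quotient is read as $0$ if $V_{n,r}(\mu)=0$). -/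

import Mathlib

open Filter Topology MeasureTheory
open scoped ENNReal NNReal

/-- `l` is the common limit of `d (f xₘ) (f yₘ) / d xₘ yₘ` along all pairs of sequences
`xₘ → x`, `yₘ → x` with `xₘ ≠ yₘ` for all `m`. -/
def HasInfDerivAt {X : Type*} [MetricSpace X] (f : X → X) (x : X) (l : ℝ) : Prop :=
  ∀ u v : ℕ → X, (∀ m, u m ≠ v m) → Tendsto u atTop (𝓝 x) → Tendsto v atTop (𝓝 x) →
    Tendsto (fun m => dist (f (u m)) (f (v m)) / dist (u m) (v m)) atTop (𝓝 l)

/-- `f` is an infinitesimal similitude at every point. -/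
def IsInfSimilitude {X : Type*} [MetricSpace X] (f : X → X) : Prop :=
  ∀ x, ∃ l, HasInfDerivAt f x l

open Classical in
/-- The number `(Df)(x)`; it is uniquely determined when `x` is not isolated and `f` is an
infinitesimal similitude at `x` (and `0` by convention when `f` is not one at `x`). -/
noncomputable def infDeriv {X : Type*} [MetricSpace X] (f : X → X) (x : X) : ℝ :=
  if h : ∃ l, HasInfDerivAt f x l then h.choose else 0

/-- An iterated function system of `N` contractive infinitesimal similitudes `f i` of `X` for which
every `D (f i)` is strictly positive and Hölder continuous. -/
structure InfSimilitudeIFS (X : Type*) [MetricSpace X] (N : ℕ) where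
  f : Fin N → X → X
  contracting : ∀ i, ∃ c : ℝ≥0, ContractingWith c (f i)
  infSimilitude : ∀ i, IsInfSimilitude (f i)
  deriv_pos : ∀ i x, 0 < infDeriv (f i) x
  deriv_holder : ∀ i, ∃ K s : ℝ≥0, 0 < s ∧ HolderWith K s (infDeriv (f i))

namespace InfSimilitudeIFS

variable {X : Type*} [MetricSpace X] {N : ℕ}

theorem continuous_f (S : InfSimilitudeIFS X N) (i : Fin N) : Continuous (S.f i) := by
  obtain ⟨c, hc⟩ := S.contracting i
  exact hc.2.continuous

theorem continuous_deriv (S : InfSimilitudeIFS X N) (i : Fin N) :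
    Continuous (infDeriv (S.f i)) := by
  obtain ⟨K, s, hs, h⟩ := S.deriv_holder i
  exact h.continuous hs

/-- `f_w = f_{w₁} ∘ ⋯ ∘ f_{wₙ}` for a word `w = w₁ ⋯ wₙ`. -/
def wordMap (S : InfSimilitudeIFS X N) : List (Fin N) → X → X
  | [] => id
  | i :: w => S.f i ∘ S.wordMap w

/-- The weight `x ↦ (p i * (D (f i) x) ^ r) ^ (σ / (r + σ))`. -/
noncomputable def weight (S : InfSimilitudeIFS X N) (p : Fin N → ℝ) (r σ : ℝ)
    (i : Fin N) (x : X) : ℝ :=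
  (p i * infDeriv (S.f i) x ^ r) ^ (σ / (r + σ))

theorem continuous_weight (S : InfSimilitudeIFS X N) (p : Fin N → ℝ) {r σ : ℝ}
    (hr : 0 < r) (hσ : 0 ≤ σ) (i : Fin N) : Continuous (S.weight p r σ i) := by
  have h1 : Continuous fun x => infDeriv (S.f i) x ^ r :=
    (S.continuous_deriv i).rpow_const fun _ => Or.inr hr.le
  exact (continuous_const.mul h1).rpow_const fun _ => Or.inr (by positivity)

/-- The operator `(L Φ)(x) = ∑ i, (p i * (D (f i) x) ^ r) ^ (σ / (r + σ)) * Φ (f i x)`. It acts on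
complex-valued continuous functions (that is, it is the complexification of the operator on
real-valued continuous functions), so that its spectral radius is the usual one. -/
noncomputable def transferOp [CompactSpace X] (S : InfSimilitudeIFS X N) (p : Fin N → ℝ) {r σ : ℝ}
    (hr : 0 < r) (hσ : 0 ≤ σ) : C(X, ℂ) →L[ℂ] C(X, ℂ) :=
  ∑ i : Fin N,
    (ContinuousLinearMap.mul ℂ C(X, ℂ)
      ⟨fun x => (S.weight p r σ i x : ℂ),
        Complex.continuous_ofReal.comp (S.continuous_weight p hr hσ i)⟩).comp
    (ContinuousMap.compCLM ℂ ℂ ⟨S.f i, S.continuous_f i⟩)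

theorem transferOp_apply [CompactSpace X] (S : InfSimilitudeIFS X N) (p : Fin N → ℝ) {r σ : ℝ}
    (hr : 0 < r) (hσ : 0 ≤ σ) (Φ : C(X, ℂ)) (x : X) :
    S.transferOp p hr hσ Φ x = ∑ i : Fin N, (S.weight p r σ i x : ℂ) * Φ (S.f i x) := by
  simp [transferOp]

end InfSimilitudeIFS

/-- The `n`-th quantization error `V_{n,r}(μ)`: the infimum of `∫ d(x, A) ^ r dμ(x)` over the sets
`A` with at most `n` points (the distance to the empty set is `∞`). -/
noncomputable def quantError {X : Type*} [MetricSpace X] [MeasurableSpace X]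
    (μ : Measure X) (n : ℕ) (r : ℝ) : ℝ≥0∞ :=
  ⨅ (A : Set X) (_ : A.encard ≤ n), ∫⁻ x, Metric.infEDist x A ^ r ∂μ

/-- `e_{n,r}(μ) = V_{n,r}(μ) ^ (1 / r)`. -/
noncomputable def quantErrorRoot {X : Type*} [MetricSpace X] [MeasurableSpace X]
    (μ : Measure X) (n : ℕ) (r : ℝ) : ℝ≥0∞ :=
  quantError μ n r ^ (1 / r)

/-- The upper quantization dimension `limsup r log n / (- log V_{n,r}(μ))`, with `- log 0 = ∞`
and `a / ∞ = 0`. -/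
noncomputable def upperQuantDim {X : Type*} [MetricSpace X] [MeasurableSpace X]
    (μ : Measure X) (r : ℝ) : EReal :=
  limsup (fun n : ℕ => ((r * Real.log n : ℝ) : EReal) / (-ENNReal.log (quantError μ n r))) atTop

/-! ### Infinitesimal derivatives: uniqueness and the chain rule. -/

section InfDeriv

variable {X : Type*} [MetricSpace X] {f g : X → X} {x : X} {l m : ℝ}

/-! Fix a point `x₀` and put `b w = p_w * (D f_w)(x₀) ^ r`, `q = σ / (r + σ)`. By the chain rule,
the `n`-th power of the transfer operator is a sum over words of length `n` with coefficients `b w ^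
q` (taken at a variable point). Bounded distortion makes these coefficients independent of the point
up to a factor `K`, hence almost multiplicative in `w`. With Gelfand's formula, spectral radius `1`
then confines every level sum of `b ^ q` to `[1 / K, K]` (`levelSum_bounds`). No eigenfunction or
eigenmeasure is needed.

Consequently `∑ b w ^ q ≤ K ^ 3` over any antichain produced by a stopping rule
(`sum_map_stoppedWords_le`). Stop each word as soon as `b w < ε`. Stopped words with `p_w ≠ 0` still
satisfy `b w ≥ c * ε`, so there are at most about `ε ^ (-q)` of them. Taking the points `f_w x₀` as
centres, the quantization error is at most a constant times `∑ b w = ∑ b w ^ q * b w ^ (1 - q)`,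
which is at most a constant times `ε ^ (r / (r + σ))` (`exists_quantError_le`). Choosing `ε` so that
the count is at most `n` gives an error of order `n ^ (-(r / σ))`, and both claims follow. -/

theorem exists_seq_tendsto_dist_div [PerfectSpace X] (x : X) :
    ∃ u : ℕ → X, (∀ n, u n ≠ x) ∧ Tendsto u atTop (𝓝 x) ∧
      ∀ (f : X → X) (l : ℝ), HasInfDerivAt f x l →
        Tendsto (fun n => dist (f (u n)) (f x) / dist (u n) x) atTop (𝓝 l) := by
  obtain ⟨u, hu⟩ := exists_seq_tendsto (𝓝[≠] x)
  obtain ⟨hu1, hu2⟩ := tendsto_nhdsWithin_iff.1 hu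
  obtain ⟨k, hk⟩ := eventually_atTop.1 hu2
  have hk' : ∀ n, u (n + k) ≠ x := fun n => hk _ (Nat.le_add_left k n)
  have ht : Tendsto (fun n => u (n + k)) atTop (𝓝 x) := (tendsto_add_atTop_iff_nat k).2 hu1
  exact ⟨fun n => u (n + k), hk', ht, fun f l h => h _ (fun _ => x) hk' ht tendsto_const_nhds⟩

theorem HasInfDerivAt.unique [PerfectSpace X] (h : HasInfDerivAt f x l)
    (h' : HasInfDerivAt f x m) : l = m := by
  obtain ⟨u, -, -, hu⟩ := exists_seq_tendsto_dist_div x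
  exact tendsto_nhds_unique (hu f l h) (hu f m h')

theorem HasInfDerivAt.infDeriv_eq [PerfectSpace X] (h : HasInfDerivAt f x l) :
    infDeriv f x = l := by
  have hex : ∃ l, HasInfDerivAt f x l := ⟨l, h⟩
  rw [infDeriv, dif_pos hex]
  exact hex.choose_spec.unique h

theorem IsInfSimilitude.hasInfDerivAt [PerfectSpace X] (h : IsInfSimilitude f) (x : X) :
    HasInfDerivAt f x (infDeriv f x) := by
  obtain ⟨l, hl⟩ := h x
  rwa [hl.infDeriv_eq]

theorem hasInfDerivAt_id : HasInfDerivAt (id : X → X) x 1 := by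
  intro u v huv _ _
  refine tendsto_const_nhds.congr fun n => ?_
  simp [div_self (dist_ne_zero.2 (huv n))]

/-- Injectivity of `f` keeps the image sequences pointwise distinct, hence admissible for `g`; the
quotients then multiply. -/
theorem HasInfDerivAt.comp (hg : HasInfDerivAt g (f x) m) (hf : HasInfDerivAt f x l)
    (hinj : Function.Injective f) (hc : ContinuousAt f x) :
    HasInfDerivAt (g ∘ f) x (m * l) := by
  intro u v huv hu hv
  have huv' : ∀ n, f (u n) ≠ f (v n) := fun n => hinj.ne (huv n)
  refine ((hg _ _ huv' (hc.tendsto.comp hu) (hc.tendsto.comp hv)).mul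
    (hf u v huv hu hv)).congr fun n => ?_
  exact div_mul_div_cancel₀ (dist_ne_zero.2 (huv' n))

theorem HasInfDerivAt.le_of_lipschitzWith [PerfectSpace X] (h : HasInfDerivAt f x l) {c : ℝ≥0}
    (hc : LipschitzWith c f) : l ≤ c := by
  obtain ⟨u, hne, -, hu⟩ := exists_seq_tendsto_dist_div x
  refine le_of_tendsto (hu f l h) (Eventually.of_forall fun n => ?_)
  exact div_le_of_le_mul₀ dist_nonneg c.2 (hc.dist_le_mul _ _)

end InfDeriv

/-! ### Derivatives and distortion along words. -/

namespace InfSimilitudeIFS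

variable {X : Type*} [MetricSpace X] {N : ℕ}

/-- The two-sided bound of `dist (f_w x) (f_w y)` by `(D f_w)(x) * dist x y`, for all words. -/
def BoundedDistortion (S : InfSimilitudeIFS X N) (C : ℝ) : Prop :=
  ∀ (w : List (Fin N)) (x y : X),
    infDeriv (S.wordMap w) x / C * dist x y ≤ dist (S.wordMap w x) (S.wordMap w y) ∧
    dist (S.wordMap w x) (S.wordMap w y) ≤ C * infDeriv (S.wordMap w) x * dist x y

theorem wordMap_append (S : InfSimilitudeIFS X N) (u v : List (Fin N)) :
    S.wordMap (u ++ v) = S.wordMap u ∘ S.wordMap v := by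
  induction u with
  | nil => rfl
  | cons i u ih => rw [List.cons_append, wordMap, ih]; rfl

theorem continuous_wordMap (S : InfSimilitudeIFS X N) (w : List (Fin N)) :
    Continuous (S.wordMap w) := by
  induction w with
  | nil => exact continuous_id
  | cons i w ih => exact (S.continuous_f i).comp ih

theorem injective_f (S : InfSimilitudeIFS X N) {C : ℝ} (hC : 0 < C)
    (hS : ∀ w : List (Fin N), w ≠ [] → ∀ x y : X,
      infDeriv (S.wordMap w) x / C * dist x y ≤ dist (S.wordMap w x) (S.wordMap w y))
    (i : Fin N) : Function.Injective (S.f i) := by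
  intro x y hxy
  have h : infDeriv (S.f i) x / C * dist x y ≤ dist (S.f i x) (S.f i y) :=
    hS [i] (by simp) x y
  rw [hxy, dist_self] at h
  have h1 : 0 < infDeriv (S.f i) x / C := div_pos (S.deriv_pos i x) hC
  exact dist_le_zero.1 (nonpos_of_mul_nonpos_right h h1)

theorem injective_wordMap (S : InfSimilitudeIFS X N) (hinj : ∀ i, Function.Injective (S.f i))
    (w : List (Fin N)) : Function.Injective (S.wordMap w) := by
  induction w with
  | nil => exact Function.injective_id
  | cons i w ih => exact (hinj i).comp ih

section Perfect

variable [PerfectSpace X]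

theorem isInfSimilitude_wordMap (S : InfSimilitudeIFS X N)
    (hinj : ∀ i, Function.Injective (S.f i)) (w : List (Fin N)) :
    IsInfSimilitude (S.wordMap w) := by
  induction w with
  | nil => exact fun x => ⟨1, hasInfDerivAt_id⟩
  | cons i w ih =>
    exact fun x => ⟨_, ((S.infSimilitude i).hasInfDerivAt _).comp (ih.hasInfDerivAt x)
      (S.injective_wordMap hinj w) (S.continuous_wordMap w).continuousAt⟩

theorem infDeriv_wordMap_nil (S : InfSimilitudeIFS X N) (x : X) :
    infDeriv (S.wordMap []) x = 1 :=
  hasInfDerivAt_id.infDeriv_eq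

theorem infDeriv_wordMap_append (S : InfSimilitudeIFS X N)
    (hinj : ∀ i, Function.Injective (S.f i)) (u v : List (Fin N)) (x : X) :
    infDeriv (S.wordMap (u ++ v)) x =
      infDeriv (S.wordMap u) (S.wordMap v x) * infDeriv (S.wordMap v) x := by
  rw [wordMap_append]
  exact (((S.isInfSimilitude_wordMap hinj u).hasInfDerivAt _).comp
    ((S.isInfSimilitude_wordMap hinj v).hasInfDerivAt x) (S.injective_wordMap hinj v)
    (S.continuous_wordMap v).continuousAt).infDeriv_eq

theorem infDeriv_wordMap_cons (S : InfSimilitudeIFS X N)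
    (hinj : ∀ i, Function.Injective (S.f i)) (i : Fin N) (w : List (Fin N)) (x : X) :
    infDeriv (S.wordMap (i :: w)) x =
      infDeriv (S.f i) (S.wordMap w x) * infDeriv (S.wordMap w) x :=
  S.infDeriv_wordMap_append hinj [i] w x

theorem infDeriv_wordMap_pos (S : InfSimilitudeIFS X N)
    (hinj : ∀ i, Function.Injective (S.f i)) (w : List (Fin N)) (x : X) :
    0 < infDeriv (S.wordMap w) x := by
  induction w with
  | nil => rw [infDeriv_wordMap_nil]; exact one_pos
  | cons i w ih => rw [S.infDeriv_wordMap_cons hinj]; exact mul_pos (S.deriv_pos _ _) ih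

theorem exists_infDeriv_wordMap_le_pow (S : InfSimilitudeIFS X N)
    (hinj : ∀ i, Function.Injective (S.f i)) :
    ∃ c : ℝ≥0, c < 1 ∧ ∀ (w : List (Fin N)) (x : X),
      infDeriv (S.wordMap w) x ≤ (c : ℝ) ^ w.length := by
  choose c hc using S.contracting
  refine ⟨Finset.univ.sup c, (Finset.sup_lt_iff (by simp)).2 fun i _ => (hc i).1, fun w x => ?_⟩
  induction w with
  | nil => rw [infDeriv_wordMap_nil]; simp
  | cons i w ih =>
    rw [S.infDeriv_wordMap_cons hinj, List.length_cons, pow_succ']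
    refine mul_le_mul ?_ ih (S.infDeriv_wordMap_pos hinj w x).le (NNReal.coe_nonneg _)
    exact (((S.infSimilitude i).hasInfDerivAt _).le_of_lipschitzWith (hc i).2).trans
      (NNReal.coe_le_coe.2 (Finset.le_sup (Finset.mem_univ i)))

/-- The empty word has derivative `1`, so enlarging the constant to at least `1` admits it. -/
theorem BoundedDistortion.of_ne_nil (S : InfSimilitudeIFS X N) {C : ℝ} (hC : 0 < C)
    (hS : ∀ w : List (Fin N), w ≠ [] → ∀ x y : X,
      infDeriv (S.wordMap w) x / C * dist x y ≤ dist (S.wordMap w x) (S.wordMap w y) ∧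
      dist (S.wordMap w x) (S.wordMap w y) ≤ C * infDeriv (S.wordMap w) x * dist x y) :
    S.BoundedDistortion (max C 1) := by
  have hinj := S.injective_f hC fun w hw x y => (hS w hw x y).1
  intro w x y
  have hpos := S.infDeriv_wordMap_pos hinj w x
  rcases eq_or_ne w [] with rfl | hw
  · rw [infDeriv_wordMap_nil]
    refine ⟨mul_le_of_le_one_left dist_nonneg ?_, le_mul_of_one_le_left dist_nonneg ?_⟩
    · exact div_le_one_of_le₀ (le_max_right _ _) (by positivity)
    · simp
  · refine ⟨le_trans ?_ (hS w hw x y).1, (hS w hw x y).2.trans ?_⟩ <;> gcongr <;>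
      exact le_max_left _ _

/-- The lower bound based at `x` and the upper bound based at `y` concern the same image distance;
cancel `dist x y`. -/
theorem BoundedDistortion.infDeriv_le (S : InfSimilitudeIFS X N) {C : ℝ} (hC : 1 ≤ C)
    (hinj : ∀ i, Function.Injective (S.f i)) (hS : S.BoundedDistortion C)
    (w : List (Fin N)) (x y : X) :
    infDeriv (S.wordMap w) x ≤ C ^ 2 * infDeriv (S.wordMap w) y := by
  have hC0 : 0 < C := one_pos.trans_le hC
  rcases eq_or_ne x y with rfl | hne
  · exact le_mul_of_one_le_left (S.infDeriv_wordMap_pos hinj w x).le (one_le_pow₀ hC)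
  · have h1 := (hS w x y).1.trans (dist_comm (S.wordMap w x) _ ▸ (hS w y x).2)
    rw [dist_comm y x] at h1
    have h2 := le_of_mul_le_mul_right h1 (dist_pos.2 hne)
    rw [div_le_iff₀ hC0] at h2
    linarith

end Perfect

end InfSimilitudeIFS

/-! ### Sums over levels and over stopped antichains of the tree of words. -/

section Words

variable {ι : Type*} [Fintype ι]

/-- The sum of `F w` over the words `w` of length `n`. -/
def levelSum {M : Type*} [AddCommMonoid M] : ℕ → (List ι → M) → M
  | 0, F => F []
  | n + 1, F => ∑ i, levelSum n fun w => F (i :: w)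

theorem levelSum_finset_sum {M κ : Type*} [AddCommMonoid M] (s : Finset κ) (n : ℕ)
    (F : κ → List ι → M) :
    levelSum n (fun w => ∑ k ∈ s, F k w) = ∑ k ∈ s, levelSum n (F k) := by
  induction n generalizing F with
  | zero => rfl
  | succ n ih =>
    simp only [levelSum, ih]
    exact Finset.sum_comm

theorem levelSum_mul_left (c : ℝ) (n : ℕ) (F : List ι → ℝ) :
    levelSum n (fun w => c * F w) = c * levelSum n F := by
  induction n generalizing F with
  | zero => rfl
  | succ n ih => simp only [levelSum, ih, Finset.mul_sum]

theorem levelSum_mul_right (c : ℝ) (n : ℕ) (F : List ι → ℝ) :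
    levelSum n (fun w => F w * c) = levelSum n F * c := by
  simp only [mul_comm _ c, levelSum_mul_left]

theorem levelSum_mono {F G : List ι → ℝ} (h : ∀ w, F w ≤ G w) (n : ℕ) :
    levelSum n F ≤ levelSum n G := by
  induction n generalizing F G with
  | zero => exact h []
  | succ n ih => exact Finset.sum_le_sum fun i _ => ih fun w => h _

theorem levelSum_nonneg {F : List ι → ℝ} (h : ∀ w, 0 ≤ F w) (n : ℕ) : 0 ≤ levelSum n F := by
  induction n generalizing F with
  | zero => exact h []
  | succ n ih => exact Finset.sum_nonneg fun i _ => ih fun w => h _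

theorem norm_levelSum_le {E : Type*} [SeminormedAddCommGroup E] (n : ℕ) (F : List ι → E) :
    ‖levelSum n F‖ ≤ levelSum n fun w => ‖F w‖ := by
  induction n generalizing F with
  | zero => rfl
  | succ n ih => exact (norm_sum_le _ _).trans (Finset.sum_le_sum fun i _ => ih _)

theorem levelSum_ofReal (n : ℕ) (F : List ι → ℝ) :
    levelSum n (fun w => (F w : ℂ)) = ((levelSum n F : ℝ) : ℂ) := by
  induction n generalizing F with
  | zero => rfl
  | succ n ih => simp only [levelSum, ih, Complex.ofReal_sum]

theorem levelSum_add (m n : ℕ) (F : List ι → ℝ) :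
    levelSum (m + n) F = levelSum m fun u => levelSum n fun v => F (u ++ v) := by
  induction m generalizing F with
  | zero => simp [levelSum]
  | succ m ih => simp only [Nat.succ_add, levelSum, ih, List.cons_append]

/-- The words obtained from `w` by extending it on the right until `P` holds, for at most `n`
steps. -/
def stoppedWords (P : List ι → Prop) [DecidablePred P] : ℕ → List ι → Multiset (List ι)
  | 0, w => {w}
  | n + 1, w => if P w then {w} else ∑ i, stoppedWords P n (w ++ [i])

variable (P : List ι → Prop) [DecidablePred P]

/-- Replacing a word by its children preserves the total of an additive `F`. Additivity is asked
only above depth `L`, so that `F` may count the descendants at a fixed level. -/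
theorem sum_map_stoppedWords {M : Type*} [AddCommMonoid M] {L : ℕ} {F : List ι → M}
    (hF : ∀ w, w.length < L → F w = ∑ i, F (w ++ [i])) (n : ℕ) (w : List ι)
    (hw : n + w.length ≤ L) : ((stoppedWords P n w).map F).sum = F w := by
  induction n generalizing w with
  | zero => simp [stoppedWords]
  | succ n ih =>
    rw [stoppedWords]
    split_ifs with h
    · simp
    · rw [← Multiset.coe_mapAddMonoidHom, map_sum, ← Multiset.coe_sumAddMonoidHom, map_sum,
        hF w (by omega)]
      refine Finset.sum_congr rfl fun i _ => ?_
      exact ih _ (by simp; omega)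

theorem stop_or_length_eq_of_mem_stoppedWords {n : ℕ} {w v : List ι}
    (hv : v ∈ stoppedWords P n w) : P v ∨ v.length = n + w.length := by
  induction n generalizing w with
  | zero => simp_all [stoppedWords]
  | succ n ih =>
    rw [stoppedWords] at hv
    split_ifs at hv with h
    · rw [Multiset.mem_singleton.1 hv]; exact Or.inl h
    · obtain ⟨i, -, hi⟩ := Multiset.mem_sum.1 hv
      refine (ih hi).imp_right fun h => ?_
      simp at h
      omega

/-- Source of the lower bound on stopped weights: the parent of a stopped word had not yet met the
criterion. -/
theorem eq_or_not_stop_of_mem_stoppedWords {n : ℕ} {w v : List ι}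
    (hv : v ∈ stoppedWords P n w) : v = w ∨ ∃ u i, v = u ++ [i] ∧ ¬ P u := by
  induction n generalizing w with
  | zero => simp_all [stoppedWords]
  | succ n ih =>
    rw [stoppedWords] at hv
    split_ifs at hv with h
    · exact Or.inl (Multiset.mem_singleton.1 hv)
    · obtain ⟨i, -, hi⟩ := Multiset.mem_sum.1 hv
      rcases ih hi with rfl | h'
      · exact Or.inr ⟨w, i, rfl, h⟩
      · exact Or.inr h'

/-- If `a` is almost supermultiplicative and its sums over the levels of the tree of words are
bounded above and below, then its sums over antichains of words are bounded. -/
theorem sum_map_stoppedWords_le {a : List ι → ℝ} {K : ℝ} (hK : 0 ≤ K) (h0 : ∀ w, 0 ≤ a w)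
    (hmul : ∀ u v, a u * a v ≤ K * a (u ++ v)) (hup : ∀ n, levelSum n a ≤ K)
    (hlow : ∀ n, 1 ≤ K * levelSum n a) (n : ℕ) :
    ((stoppedWords P n []).map a).sum ≤ K ^ 3 := by
  -- The sum of `a` over the descendants of `w` at level `n` is additive in `w`, so its total over
  -- the stopped words is the full level sum. Below, `a w` is at most `K ^ 2` times this sum.
  have key := sum_map_stoppedWords P (L := n)
    (F := fun w => levelSum (n - w.length) fun v => a (w ++ v))
    (fun w hw => by
      obtain ⟨k, hk⟩ := Nat.exists_eq_add_of_lt hw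
      have h1 : n - w.length = k + 1 := by omega
      have h2 : n - (w.length + 1) = k := by omega
      simp [h1, h2, levelSum]) n [] (by simp)
  have hle : ((stoppedWords P n []).map a).sum ≤ ((stoppedWords P n []).map
      fun w => K ^ 2 * levelSum (n - w.length) fun v => a (w ++ v)).sum := by
    refine Multiset.sum_map_le_sum_map _ _ fun w _ => ?_
    calc a w = a w * 1 := (mul_one _).symm
      _ ≤ a w * (K * levelSum (n - w.length) a) := mul_le_mul_of_nonneg_left (hlow _) (h0 w)
      _ = K * levelSum (n - w.length) fun v => a w * a v := by rw [levelSum_mul_left]; ring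
      _ ≤ K * levelSum (n - w.length) fun v => K * a (w ++ v) :=
        mul_le_mul_of_nonneg_left (levelSum_mono (hmul w) _) hK
      _ = _ := by rw [levelSum_mul_left]; ring
  rw [Multiset.sum_map_mul_left, key] at hle
  refine hle.trans ?_
  simp only [List.length_nil, List.nil_append, tsub_zero]
  calc K ^ 2 * levelSum n (fun v => a v) ≤ K ^ 2 * K :=
        mul_le_mul_of_nonneg_left (hup n) (by positivity)
    _ = K ^ 3 := by ring

/-- Level sums inherit supermultiplicativity up to `K`. A level sum above `K` would thus force
exponential growth. -/
theorem pow_levelSum_le {a : List ι → ℝ} {K : ℝ} (hK : 0 < K) (h0 : ∀ w, 0 ≤ a w)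
    (hnil : a [] = 1) (hmul : ∀ u v, a u * a v ≤ K * a (u ++ v)) (n k : ℕ) :
    (levelSum n a / K) ^ k ≤ levelSum (n * k) a := by
  induction k with
  | zero => simp [levelSum, hnil]
  | succ k ih =>
    have hsum : levelSum (n * k) a * levelSum n a ≤ K * levelSum (n * k + n) a := by
      rw [levelSum_add, ← levelSum_mul_left K, ← levelSum_mul_right]
      refine levelSum_mono (fun u => ?_) _
      rw [← levelSum_mul_left, ← levelSum_mul_left]
      exact levelSum_mono (hmul u) _
    rw [pow_succ, Nat.mul_succ, mul_div_assoc', div_le_iff₀ hK, mul_comm _ K]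
    exact (mul_le_mul_of_nonneg_right ih (levelSum_nonneg h0 n)).trans hsum

end Words

/-! ### Word weights and powers of the transfer operator. -/

namespace InfSimilitudeIFS

variable {X : Type*} [MetricSpace X] {N : ℕ}

/-- The number `p_w * (D f_w)(x) ^ r`. -/
noncomputable def wordWeight (S : InfSimilitudeIFS X N) (p : Fin N → ℝ) (r : ℝ)
    (w : List (Fin N)) (x : X) : ℝ :=
  (w.map p).prod * infDeriv (S.wordMap w) x ^ r

theorem prod_map_nonneg {p : Fin N → ℝ} (hp : ∀ i, 0 ≤ p i) (w : List (Fin N)) :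
    0 ≤ (w.map p).prod :=
  List.prod_nonneg (by simpa using fun i _ => hp i)

theorem wordWeight_nonneg [PerfectSpace X] (S : InfSimilitudeIFS X N)
    (hinj : ∀ i, Function.Injective (S.f i)) {p : Fin N → ℝ} (hp : ∀ i, 0 ≤ p i) (r : ℝ)
    (w : List (Fin N)) (x : X) : 0 ≤ S.wordWeight p r w x :=
  mul_nonneg (prod_map_nonneg hp w) (Real.rpow_nonneg (S.infDeriv_wordMap_pos hinj w x).le r)

theorem wordWeight_nil [PerfectSpace X] (S : InfSimilitudeIFS X N) (p : Fin N → ℝ) (r : ℝ)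
    (x : X) : S.wordWeight p r [] x = 1 := by
  simp [wordWeight, infDeriv_wordMap_nil]

theorem wordWeight_append [PerfectSpace X] (S : InfSimilitudeIFS X N)
    (hinj : ∀ i, Function.Injective (S.f i)) (p : Fin N → ℝ) (r : ℝ)
    (u v : List (Fin N)) (x : X) :
    S.wordWeight p r (u ++ v) x = S.wordWeight p r u (S.wordMap v x) * S.wordWeight p r v x := by
  rw [wordWeight, S.infDeriv_wordMap_append hinj, Real.mul_rpow
    (S.infDeriv_wordMap_pos hinj _ _).le (S.infDeriv_wordMap_pos hinj _ _).le, List.map_append,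
    List.prod_append, wordWeight, wordWeight]
  ring

theorem wordWeight_le [PerfectSpace X] (S : InfSimilitudeIFS X N)
    (hinj : ∀ i, Function.Injective (S.f i)) {C : ℝ} (hC : 1 ≤ C) (hS : S.BoundedDistortion C)
    {p : Fin N → ℝ} (hp : ∀ i, 0 ≤ p i) {r : ℝ} (hr : 0 ≤ r) (w : List (Fin N)) (x y : X) :
    S.wordWeight p r w x ≤ (C ^ 2) ^ r * S.wordWeight p r w y := by
  have h := Real.rpow_le_rpow (S.infDeriv_wordMap_pos hinj w x).le
    (hS.infDeriv_le S hC hinj w x y) hr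
  rw [Real.mul_rpow (by positivity) (S.infDeriv_wordMap_pos hinj w y).le] at h
  calc S.wordWeight p r w x
      ≤ (w.map p).prod * ((C ^ 2) ^ r * infDeriv (S.wordMap w) y ^ r) :=
        mul_le_mul_of_nonneg_left h (prod_map_nonneg hp w)
    _ = _ := by rw [wordWeight]; ring

theorem wordWeight_mul_le [PerfectSpace X] (S : InfSimilitudeIFS X N)
    (hinj : ∀ i, Function.Injective (S.f i)) {C : ℝ} (hC : 1 ≤ C) (hS : S.BoundedDistortion C)
    {p : Fin N → ℝ} (hp : ∀ i, 0 ≤ p i) {r : ℝ} (hr : 0 ≤ r) (u v : List (Fin N)) (x : X) :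
    S.wordWeight p r u x * S.wordWeight p r v x ≤
      (C ^ 2) ^ r * S.wordWeight p r (u ++ v) x := by
  rw [S.wordWeight_append hinj, ← mul_assoc]
  exact mul_le_mul_of_nonneg_right (S.wordWeight_le hinj hC hS hp hr u x _)
    (S.wordWeight_nonneg hinj hp r v x)

theorem wordWeight_rpow_le [PerfectSpace X] (S : InfSimilitudeIFS X N)
    (hinj : ∀ i, Function.Injective (S.f i)) {C : ℝ} (hC : 1 ≤ C) (hS : S.BoundedDistortion C)
    {p : Fin N → ℝ} (hp : ∀ i, 0 ≤ p i) {r : ℝ} (hr : 0 ≤ r) {q : ℝ} (hq : 0 ≤ q)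
    (w : List (Fin N)) (x y : X) :
    S.wordWeight p r w x ^ q ≤ ((C ^ 2) ^ r) ^ q * S.wordWeight p r w y ^ q := by
  rw [← Real.mul_rpow (by positivity) (S.wordWeight_nonneg hinj hp r w y)]
  exact Real.rpow_le_rpow (S.wordWeight_nonneg hinj hp r w x)
    (S.wordWeight_le hinj hC hS hp hr w x y) hq

theorem wordWeight_rpow_mul_le [PerfectSpace X] (S : InfSimilitudeIFS X N)
    (hinj : ∀ i, Function.Injective (S.f i)) {C : ℝ} (hC : 1 ≤ C) (hS : S.BoundedDistortion C)
    {p : Fin N → ℝ} (hp : ∀ i, 0 ≤ p i) {r : ℝ} (hr : 0 ≤ r) {q : ℝ} (hq : 0 ≤ q)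
    (u v : List (Fin N)) (x : X) :
    S.wordWeight p r u x ^ q * S.wordWeight p r v x ^ q ≤
      ((C ^ 2) ^ r) ^ q * S.wordWeight p r (u ++ v) x ^ q := by
  have h0 := S.wordWeight_nonneg hinj hp r
  rw [← Real.mul_rpow (h0 u x) (h0 v x), ← Real.mul_rpow (by positivity) (h0 _ x)]
  exact Real.rpow_le_rpow (mul_nonneg (h0 u x) (h0 v x))
    (S.wordWeight_mul_le hinj hC hS hp hr u v x) hq

theorem weight_mul_wordWeight [PerfectSpace X] (S : InfSimilitudeIFS X N)
    (hinj : ∀ i, Function.Injective (S.f i)) {p : Fin N → ℝ} (hp : ∀ i, 0 ≤ p i) (r σ : ℝ)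
    (i : Fin N) (w : List (Fin N)) (x : X) :
    S.weight p r σ i (S.wordMap w x) * S.wordWeight p r w x ^ (σ / (r + σ)) =
      S.wordWeight p r (i :: w) x ^ (σ / (r + σ)) := by
  have h := S.wordWeight_append hinj p r [i] w x
  have h1 : S.wordWeight p r [i] (S.wordMap w x) =
      p i * infDeriv (S.f i) (S.wordMap w x) ^ r := by
    rw [wordWeight, List.map_singleton, List.prod_singleton]; rfl
  rw [List.singleton_append] at h
  rw [h, Real.mul_rpow (S.wordWeight_nonneg hinj hp r _ _) (S.wordWeight_nonneg hinj hp r _ _),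
    h1, weight]

theorem transferOp_pow_apply [CompactSpace X] [PerfectSpace X] (S : InfSimilitudeIFS X N)
    (hinj : ∀ i, Function.Injective (S.f i)) {p : Fin N → ℝ} (hp : ∀ i, 0 ≤ p i) {r σ : ℝ}
    (hr : 0 < r) (hσ : 0 ≤ σ) (n : ℕ) (Φ : C(X, ℂ)) (x : X) :
    (S.transferOp p hr hσ ^ n) Φ x = levelSum n fun w =>
      ((S.wordWeight p r w x ^ (σ / (r + σ)) : ℝ) : ℂ) * Φ (S.wordMap w x) := by
  induction n generalizing Φ with
  | zero => simp [levelSum, wordWeight_nil, wordMap]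
  | succ n ih =>
    -- The induction hypothesis is applied to `L Φ`: the extra factor acts at `f_w x` and so
    -- prepends the letter `i`.
    rw [pow_succ, mul_apply_eq_comp, ih]
    simp only [transferOp_apply, Finset.mul_sum, levelSum_finset_sum, levelSum]
    refine Finset.sum_congr rfl fun i _ => congrArg _ (funext fun w => ?_)
    rw [← S.weight_mul_wordWeight hinj hp r σ i w x, Complex.ofReal_mul, wordMap,
      Function.comp_apply]
    ring

theorem norm_transferOp_pow_le [CompactSpace X] [PerfectSpace X] (S : InfSimilitudeIFS X N)
    (hinj : ∀ i, Function.Injective (S.f i)) {C : ℝ} (hC : 1 ≤ C) (hS : S.BoundedDistortion C)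
    {p : Fin N → ℝ} (hp : ∀ i, 0 ≤ p i) {r σ : ℝ} (hr : 0 < r) (hσ : 0 ≤ σ) (n : ℕ) (x₀ : X) :
    ‖S.transferOp p hr hσ ^ n‖ ≤ ((C ^ 2) ^ r) ^ (σ / (r + σ)) *
      levelSum n fun w => S.wordWeight p r w x₀ ^ (σ / (r + σ)) := by
  have h0 : ∀ w x, 0 ≤ S.wordWeight p r w x ^ (σ / (r + σ)) := fun w x =>
    Real.rpow_nonneg (S.wordWeight_nonneg hinj hp r w x) _
  have hB := mul_nonneg (show 0 ≤ ((C ^ 2) ^ r) ^ (σ / (r + σ)) by positivity)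
    (levelSum_nonneg (fun w => h0 w x₀) n)
  refine ContinuousLinearMap.opNorm_le_bound _ hB fun Φ => ?_
  refine (ContinuousMap.norm_le _ (mul_nonneg hB (norm_nonneg _))).2 fun x => ?_
  rw [S.transferOp_pow_apply hinj hp hr hσ, ← levelSum_mul_left, ← levelSum_mul_right]
  refine (norm_levelSum_le _ _).trans (levelSum_mono (fun w => ?_) n)
  rw [norm_mul, Complex.norm_real, Real.norm_of_nonneg (h0 w x)]
  exact mul_le_mul (S.wordWeight_rpow_le hinj hC hS hp hr.le (by positivity) w x x₀)
    (Φ.norm_coe_le_norm _) (norm_nonneg _) (mul_nonneg (by positivity) (h0 w x₀))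

/-- Evaluate the operator on the constant function `1` at `x₀`. -/
theorem levelSum_le_norm_transferOp_pow [CompactSpace X] [PerfectSpace X]
    (S : InfSimilitudeIFS X N) (hinj : ∀ i, Function.Injective (S.f i)) {p : Fin N → ℝ}
    (hp : ∀ i, 0 ≤ p i) {r σ : ℝ} (hr : 0 < r) (hσ : 0 ≤ σ) (n : ℕ) (x₀ : X) :
    levelSum n (fun w => S.wordWeight p r w x₀ ^ (σ / (r + σ))) ≤
      ‖S.transferOp p hr hσ ^ n‖ := by
  have : Nonempty X := ⟨x₀⟩
  have h0 : ∀ w, 0 ≤ S.wordWeight p r w x₀ ^ (σ / (r + σ)) := fun w =>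
    Real.rpow_nonneg (S.wordWeight_nonneg hinj hp r w x₀) _
  have h1 := (ContinuousMap.norm_coe_le_norm ((S.transferOp p hr hσ ^ n) 1) x₀).trans
    ((S.transferOp p hr hσ ^ n).le_opNorm 1)
  rw [S.transferOp_pow_apply hinj hp hr hσ, norm_one, mul_one] at h1
  simp only [ContinuousMap.one_apply, mul_one] at h1
  rwa [levelSum_ofReal, Complex.norm_real, Real.norm_of_nonneg (levelSum_nonneg h0 n)] at h1

theorem one_le_norm_pow_of_spectralRadius_eq_one {E : Type*} [NormedAddCommGroup E]
    [NormedSpace ℂ E] [CompleteSpace E] [Nontrivial E] {a : E →L[ℂ] E}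
    (ha : spectralRadius ℂ a = 1) (n : ℕ) :
    1 ≤ ‖a ^ n‖ := by
  rcases n with _ | n
  · simp
  by_contra! hlt
  have h := spectrum.spectralRadius_le_pow_nnnorm_pow_one_div ℂ a n
  rw [ha, nnnorm_one, ENNReal.coe_one, ENNReal.one_rpow, mul_one] at h
  have h2 : (‖a ^ (n + 1)‖₊ : ℝ≥0∞) < 1 := by exact_mod_cast hlt
  exact absurd h (not_le.2 (ENNReal.rpow_lt_one h2 (by positivity)))

/-- Gelfand's formula along the multiples of `n` gives `ρ ^ (1 / n) ≤ 1`. -/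
theorem le_one_of_pow_le_norm_pow {E : Type*} [NormedAddCommGroup E] [NormedSpace ℂ E]
    [CompleteSpace E] {a : E →L[ℂ] E} (ha : spectralRadius ℂ a = 1) {n : ℕ} (hn : n ≠ 0) {ρ : ℝ}
    (h : ∀ k : ℕ, ρ ^ k ≤ ‖a ^ (n * k)‖) : ρ ≤ 1 := by
  by_contra! hρ
  have hlim := (spectrum.pow_nnnorm_pow_one_div_tendsto_nhds_spectralRadius a).comp
    (tendsto_id.const_mul_atTop' (Nat.pos_of_ne_zero hn) : Tendsto (fun k => n * k) atTop atTop)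
  rw [ha] at hlim
  have hle : ENNReal.ofReal ρ ^ (1 / n : ℝ) ≤ 1 := by
    refine ge_of_tendsto hlim ((eventually_gt_atTop 0).mono fun k hk => ?_)
    have hk' : (k : ℝ) ≠ 0 := by positivity
    have h1 : ENNReal.ofReal ρ ^ (k : ℝ) ≤ (‖a ^ (n * k)‖₊ : ℝ≥0∞) := by
      rw [ENNReal.rpow_natCast, ← ENNReal.ofReal_pow (by positivity), ← enorm_eq_nnnorm,
        ← ofReal_norm]
      exact ENNReal.ofReal_le_ofReal (h k)
    calc ENNReal.ofReal ρ ^ (1 / n : ℝ) = (ENNReal.ofReal ρ ^ (k : ℝ)) ^ (1 / (n * k : ℕ) : ℝ) := by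
          rw [← ENNReal.rpow_mul]; congr 1; push_cast; field_simp
      _ ≤ _ := ENNReal.rpow_le_rpow h1 (by positivity)
  exact absurd hle (not_le.2 (ENNReal.one_lt_rpow (by simpa using hρ) (by positivity)))

/-- The level sum is comparable to the norm of the power. The lower bound uses that the norm of
every power is at least `1`; the upper one excludes exponential growth. -/
theorem levelSum_bounds [CompactSpace X] [PerfectSpace X] (S : InfSimilitudeIFS X N)
    (hinj : ∀ i, Function.Injective (S.f i)) {C : ℝ} (hC : 1 ≤ C) (hS : S.BoundedDistortion C)
    {p : Fin N → ℝ} (hp : ∀ i, 0 ≤ p i) {r σ : ℝ} (hr : 0 < r) (hσ : 0 ≤ σ) (x₀ : X)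
    (hspr : spectralRadius ℂ (S.transferOp p hr hσ) = 1) (n : ℕ) :
    levelSum n (fun w => S.wordWeight p r w x₀ ^ (σ / (r + σ))) ≤
        ((C ^ 2) ^ r) ^ (σ / (r + σ)) ∧
      1 ≤ ((C ^ 2) ^ r) ^ (σ / (r + σ)) *
        levelSum n fun w => S.wordWeight p r w x₀ ^ (σ / (r + σ)) := by
  have : Nonempty X := ⟨x₀⟩
  have hq : 0 ≤ σ / (r + σ) := by positivity
  have hK : 1 ≤ ((C ^ 2) ^ r) ^ (σ / (r + σ)) :=
    Real.one_le_rpow (Real.one_le_rpow (one_le_pow₀ hC) hr.le) hq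
  have hK0 := one_pos.trans_le hK
  have h0 : ∀ w, 0 ≤ S.wordWeight p r w x₀ ^ (σ / (r + σ)) := fun w =>
    Real.rpow_nonneg (S.wordWeight_nonneg hinj hp r w x₀) _
  have hnil : S.wordWeight p r [] x₀ ^ (σ / (r + σ)) = 1 := by
    rw [wordWeight_nil, Real.one_rpow]
  have hmul : ∀ u v, S.wordWeight p r u x₀ ^ (σ / (r + σ)) *
      S.wordWeight p r v x₀ ^ (σ / (r + σ)) ≤ ((C ^ 2) ^ r) ^ (σ / (r + σ)) *
        S.wordWeight p r (u ++ v) x₀ ^ (σ / (r + σ)) := fun u v =>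
    S.wordWeight_rpow_mul_le hinj hC hS hp hr.le hq u v x₀
  have hle : ∀ k, levelSum k (fun w => S.wordWeight p r w x₀ ^ (σ / (r + σ))) ≤
      ‖S.transferOp p hr hσ ^ k‖ := fun k =>
    S.levelSum_le_norm_transferOp_pow hinj hp hr hσ k x₀
  have hge : ‖S.transferOp p hr hσ ^ n‖ ≤ ((C ^ 2) ^ r) ^ (σ / (r + σ)) *
      levelSum n fun w => S.wordWeight p r w x₀ ^ (σ / (r + σ)) :=
    S.norm_transferOp_pow_le hinj hC hS hp hr hσ n x₀
  have hone : 1 ≤ ‖S.transferOp p hr hσ ^ n‖ := one_le_norm_pow_of_spectralRadius_eq_one hspr n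
  generalize ((C ^ 2) ^ r) ^ (σ / (r + σ)) = K at *
  constructor
  · rcases eq_or_ne n 0 with rfl | hn
    · exact hnil.trans_le hK
    · rw [← div_le_one hK0]
      exact le_one_of_pow_le_norm_pow hspr hn fun k =>
        (pow_levelSum_le hK0 h0 hnil hmul n k).trans (hle _)
  · exact hone.trans hge

end InfSimilitudeIFS

/-! ### Quantization error of the centres given by stopped words. -/

theorem quantError_anti {X : Type*} [MetricSpace X] [MeasurableSpace X] (μ : Measure X) (r : ℝ)
    {m n : ℕ} (h : m ≤ n) : quantError μ n r ≤ quantError μ m r :=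
  le_iInf₂ fun A hA => iInf₂_le A (hA.trans (by exact_mod_cast h))

namespace InfSimilitudeIFS

variable {X : Type*} [MetricSpace X] {N : ℕ}

theorem lintegral_invariant [MeasurableSpace X] [BorelSpace X] (S : InfSimilitudeIFS X N)
    {p : Fin N → ℝ} {μ : Measure X} (hμ : μ = ∑ i, ENNReal.ofReal (p i) • μ.map (S.f i))
    {g : X → ℝ≥0∞} (hg : Measurable g) :
    ∫⁻ x, g x ∂μ = ∑ i, ENNReal.ofReal (p i) * ∫⁻ x, g (S.f i x) ∂μ := by
  conv_lhs => rw [hμ]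
  rw [lintegral_finsetSum_measure]
  refine Finset.sum_congr rfl fun i _ => ?_
  rw [lintegral_smul_measure, lintegral_map hg (S.continuous_f i).measurable, smul_eq_mul]

/-- Invariance of `μ` says exactly that `w ↦ p_w * ∫ g ∘ f_w` is additive under one-letter
extension. -/
theorem lintegral_stoppedWords [MeasurableSpace X] [BorelSpace X] (S : InfSimilitudeIFS X N)
    {p : Fin N → ℝ} (hp : ∀ i, 0 ≤ p i) {μ : Measure X}
    (hμ : μ = ∑ i, ENNReal.ofReal (p i) • μ.map (S.f i))
    {g : X → ℝ≥0∞} (hg : Measurable g) (P : List (Fin N) → Prop) [DecidablePred P] (n : ℕ) :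
    ((stoppedWords P n []).map fun w =>
      ENNReal.ofReal (w.map p).prod * ∫⁻ x, g (S.wordMap w x) ∂μ).sum = ∫⁻ x, g x ∂μ := by
  rw [sum_map_stoppedWords P (L := n) (fun w _ => ?_) n [] (by simp)]
  · simp [wordMap]
  · rw [S.lintegral_invariant hμ (g := fun x => g (S.wordMap w x))
      (hg.comp (S.continuous_wordMap w).measurable), Finset.mul_sum]
    refine Finset.sum_congr rfl fun i _ => ?_
    rw [← mul_assoc, ← ENNReal.ofReal_mul (prod_map_nonneg hp w), wordMap_append]
    simp [wordMap]

theorem quantError_stoppedWords_le [CompactSpace X] [PerfectSpace X] [MeasurableSpace X]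
    [BorelSpace X] (S : InfSimilitudeIFS X N) (hinj : ∀ i, Function.Injective (S.f i)) {C : ℝ}
    (hC : 1 ≤ C) (hS : S.BoundedDistortion C) {p : Fin N → ℝ} (hp : ∀ i, 0 ≤ p i)
    {μ : Measure X} [IsProbabilityMeasure μ]
    (hμ : μ = ∑ i, ENNReal.ofReal (p i) • μ.map (S.f i)) {r : ℝ} (hr : 0 < r) (x₀ : X)
    (P : List (Fin N) → Prop) [DecidablePred P] (n : ℕ) :
    quantError μ ((stoppedWords P n []).filter fun w => (w.map p).prod ≠ 0).card r ≤
      ENNReal.ofReal ((C * Metric.diam (Set.univ : Set X)) ^ r *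
        ((stoppedWords P n []).map fun w => S.wordWeight p r w x₀).sum) := by
  classical
  -- Words with `p_w = 0` contribute nothing to the integral and get no centre; their weights have
  -- no lower bound by which to count them.
  set Γ := (stoppedWords P n []).filter fun w => (w.map p).prod ≠ 0 with hΓ
  set A : Finset X := (Γ.map fun w => S.wordMap w x₀).toFinset with hA
  have hcard : (A : Set X).encard ≤ Γ.card := by
    rw [Set.encard_coe_eq_coe_finsetCard]
    exact_mod_cast (Multiset.toFinset_card_le _).trans_eq (Multiset.card_map _ _)
  refine (iInf₂_le (A : Set X) hcard).trans ?_
  rw [← S.lintegral_stoppedWords hp hμ (measurable_infEDist.pow_const r) P n,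
    ← Multiset.sum_map_mul_left]
  have hterm : ∀ w ∈ stoppedWords P n [], ENNReal.ofReal (w.map p).prod *
      ∫⁻ x, Metric.infEDist (S.wordMap w x) A ^ r ∂μ ≤
      ENNReal.ofReal ((C * Metric.diam (Set.univ : Set X)) ^ r * S.wordWeight p r w x₀) := by
    intro w hw
    by_cases h0 : (w.map p).prod = 0
    · simp [h0]
    have hD := (S.infDeriv_wordMap_pos hinj w x₀).le
    have hd : 0 ≤ Metric.diam (Set.univ : Set X) := Metric.diam_nonneg
    have hmem : S.wordMap w x₀ ∈ (A : Set X) := by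
      simp only [hA, hΓ, Finset.mem_coe, Multiset.mem_toFinset, Multiset.mem_map,
        Multiset.mem_filter]
      exact ⟨w, ⟨hw, h0⟩, rfl⟩
    have hpt : ∀ x, Metric.infEDist (S.wordMap w x) A ^ r ≤ ENNReal.ofReal
        ((C * infDeriv (S.wordMap w) x₀ * Metric.diam (Set.univ : Set X)) ^ r) := by
      intro x
      rw [← ENNReal.ofReal_rpow_of_nonneg (by positivity) hr.le]
      refine ENNReal.rpow_le_rpow ((Metric.infEDist_le_edist_of_mem hmem).trans ?_) hr.le
      rw [edist_comm, edist_dist]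
      refine ENNReal.ofReal_le_ofReal ((hS w x₀ x).2.trans ?_)
      exact mul_le_mul_of_nonneg_left (Metric.dist_le_diam_of_mem
        isCompact_univ.isBounded (Set.mem_univ _) (Set.mem_univ _)) (by positivity)
    have hint : ∫⁻ x, Metric.infEDist (S.wordMap w x) A ^ r ∂μ ≤ ENNReal.ofReal
        ((C * infDeriv (S.wordMap w) x₀ * Metric.diam (Set.univ : Set X)) ^ r) :=
      (lintegral_mono hpt).trans_eq (by simp)
    refine (mul_le_mul_right hint _).trans_eq ?_
    rw [← ENNReal.ofReal_mul (prod_map_nonneg hp w), wordWeight, mul_right_comm C,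
      Real.mul_rpow (by positivity) hD]
    congr 1
    ring
  refine (Multiset.sum_map_le_sum_map _ _ hterm).trans_eq ?_
  have hnn : ∀ w, 0 ≤ (C * Metric.diam (Set.univ : Set X)) ^ r * S.wordWeight p r w x₀ :=
    fun w => mul_nonneg (Real.rpow_nonneg (mul_nonneg (by positivity) Metric.diam_nonneg) r)
      (S.wordWeight_nonneg hinj hp r w x₀)
  induction stoppedWords P n [] using Multiset.induction_on with
  | empty => simp
  | cons w s ih =>
    rw [Multiset.map_cons, Multiset.sum_cons, ih, Multiset.map_cons, Multiset.sum_cons,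
      ENNReal.ofReal_add (hnn w)]
    exact Multiset.sum_nonneg (by simpa using fun v _ => hnn v)

/-- Derivatives decay geometrically in the word length and `p_w ≤ 1`. Hence the stopping rule `b w <
ε` takes effect within a uniform depth. -/
theorem exists_length_forall_wordWeight_lt [PerfectSpace X] (S : InfSimilitudeIFS X N)
    (hinj : ∀ i, Function.Injective (S.f i)) {p : Fin N → ℝ} (hp : ∀ i, 0 ≤ p i)
    (hp1 : ∑ i, p i = 1) {r : ℝ} (hr : 0 < r) {ε : ℝ} (hε : 0 < ε) :
    ∃ n : ℕ, ∀ (w : List (Fin N)) (x : X), w.length = n → S.wordWeight p r w x < ε := by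
  obtain ⟨c, hc, hcw⟩ := S.exists_infDeriv_wordMap_le_pow hinj
  obtain ⟨n, hn⟩ := exists_pow_lt_of_lt_one (Real.rpow_pos_of_pos hε (1 / r))
    (NNReal.coe_lt_one.2 hc)
  refine ⟨n, fun w x hw => ?_⟩
  have h1 : (w.map p).prod ≤ 1 := by
    clear hw
    induction w with
    | nil => simp
    | cons i w ih =>
      rw [List.map_cons, List.prod_cons]
      exact mul_le_one₀ (hp1 ▸ Finset.single_le_sum (fun j _ => hp j) (Finset.mem_univ i))
        (prod_map_nonneg hp w) ih
  have hD := S.infDeriv_wordMap_pos hinj w x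
  calc S.wordWeight p r w x ≤ 1 * infDeriv (S.wordMap w) x ^ r :=
        mul_le_mul_of_nonneg_right h1 (by positivity)
    _ = infDeriv (S.wordMap w) x ^ r := one_mul _
    _ < (ε ^ (1 / r)) ^ r :=
        Real.rpow_lt_rpow hD.le ((hw ▸ hcw w x).trans_lt hn) hr
    _ = ε := by rw [← Real.rpow_mul hε.le, one_div_mul_cancel hr.ne', Real.rpow_one]

theorem exists_quantError_le [CompactSpace X] [PerfectSpace X] [MeasurableSpace X]
    [BorelSpace X] (S : InfSimilitudeIFS X N) (hinj : ∀ i, Function.Injective (S.f i)) {C : ℝ}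
    (hC : 1 ≤ C) (hS : S.BoundedDistortion C) {p : Fin N → ℝ} (hp : ∀ i, 0 ≤ p i)
    (hp1 : ∑ i, p i = 1) {μ : Measure X} [IsProbabilityMeasure μ]
    (hμ : μ = ∑ i, ENNReal.ofReal (p i) • μ.map (S.f i)) {r σ : ℝ} (hr : 0 < r) (hσ : 0 < σ)
    (hspr : spectralRadius ℂ (S.transferOp p hr hσ.le) = 1) :
    ∃ c B : ℝ, 0 < c ∧ 0 < B ∧ ∀ ε : ℝ, 0 < ε → ε ≤ 1 → ∃ k : ℕ,
      k * (c * ε) ^ (σ / (r + σ)) ≤ B ∧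
      quantError μ k r ≤ ENNReal.ofReal (B * ε ^ (r / (r + σ))) := by
  classical
  obtain ⟨x₀⟩ : Nonempty X := nonempty_of_isProbabilityMeasure μ
  have hq : 0 < σ / (r + σ) := by positivity
  have hK : 1 ≤ ((C ^ 2) ^ r) ^ (σ / (r + σ)) :=
    Real.one_le_rpow (Real.one_le_rpow (one_le_pow₀ hC) hr.le) hq.le
  have hκ : 1 ≤ (C ^ 2) ^ r := Real.one_le_rpow (one_le_pow₀ hC) hr.le
  have hb := fun w => S.wordWeight_nonneg hinj hp r w x₀
  have hbmul := fun u v => S.wordWeight_mul_le hinj hC hS hp hr.le u v x₀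
  have hZ := fun n => S.levelSum_bounds hinj hC hS hp hr hσ.le x₀ hspr n
  have hsum := fun (P : List (Fin N) → Prop) [DecidablePred P] n =>
    sum_map_stoppedWords_le P (zero_le_one.trans hK) (fun w => Real.rpow_nonneg (hb w) _)
      (fun u v => S.wordWeight_rpow_mul_le hinj hC hS hp hr.le hq.le u v x₀)
      (fun n => (hZ n).1) (fun n => (hZ n).2) n
  have hquant := fun (P : List (Fin N) → Prop) [DecidablePred P] n =>
    S.quantError_stoppedWords_le hinj hC hS hp hμ hr x₀ P n
  have hdepth := fun (ε : ℝ) (hε : 0 < ε) =>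
    S.exists_length_forall_wordWeight_lt hinj hp hp1 hr hε
  have hnil : S.wordWeight p r [] x₀ = 1 := S.wordWeight_nil p r x₀
  have hprod : ∀ w, S.wordWeight p r w x₀ = (w.map p).prod * infDeriv (S.wordMap w) x₀ ^ r :=
    fun w => rfl
  have hpos := fun w => Real.rpow_pos_of_pos (S.infDeriv_wordMap_pos hinj w x₀) r
  have hd : 0 ≤ (C * Metric.diam (Set.univ : Set X)) ^ r :=
    Real.rpow_nonneg (mul_nonneg (by positivity) Metric.diam_nonneg) r
  -- `β` bounds the loss of weight caused by appending one letter of positive probability, up to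
  -- distortion.
  obtain ⟨β, hβ0, hβ⟩ : ∃ β : ℝ, 0 < β ∧ ∀ i, p i ≠ 0 → β ≤ S.wordWeight p r [i] x₀ := by
    have h : ∀ i : Fin N, ∀ᶠ β in 𝓝[>] (0 : ℝ), p i ≠ 0 → β ≤ S.wordWeight p r [i] x₀ := by
      intro i
      by_cases hi : p i = 0
      · exact Eventually.of_forall fun β h => absurd hi h
      · have : 0 < S.wordWeight p r [i] x₀ := by
          rw [hprod, List.map_singleton, List.prod_singleton]
          exact mul_pos (lt_of_le_of_ne (hp i) (Ne.symm hi)) (hpos _)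
        filter_upwards [Ioo_mem_nhdsGT this] with β hβ _ using hβ.2.le
    obtain ⟨β, h1, h2⟩ := ((eventually_all.2 h).and self_mem_nhdsWithin).exists
    exact ⟨β, h2, h1⟩
  generalize ((C ^ 2) ^ r) ^ (σ / (r + σ)) = K at *
  generalize (C ^ 2) ^ r = κ at *
  generalize (C * Metric.diam (Set.univ : Set X)) ^ r = d at *
  have hκ0 : 0 < κ := one_pos.trans_le hκ
  have hK0 : 0 < K := one_pos.trans_le hK
  -- Since `d + 1` is at least both `1` and `d`, a single constant serves the count and the error.
  refine ⟨β / κ, (d + 1) * K ^ 3, by positivity, by positivity, fun ε hε hε1 => ?_⟩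
  obtain ⟨n, hn⟩ := hdepth ε hε
  set P : List (Fin N) → Prop := fun w => S.wordWeight p r w x₀ < ε with hP
  have hlt : ∀ w ∈ stoppedWords P n [], S.wordWeight p r w x₀ < ε := fun w hw =>
    (stop_or_length_eq_of_mem_stoppedWords P hw).elim id fun h => hn w x₀ (by simpa using h)
  have hge : ∀ w ∈ stoppedWords P n [], (w.map p).prod ≠ 0 →
      β / κ * ε ≤ S.wordWeight p r w x₀ := by
    intro w hw h0
    rcases eq_or_not_stop_of_mem_stoppedWords P hw with rfl | ⟨u, i, rfl, hu⟩
    -- The empty word has weight `1 ≥ ε`, so it is never a stopped word and a parent always exists.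
    · exact absurd (hlt _ hw) (by rw [hnil]; exact not_lt.2 hε1)
    · have hi : p i ≠ 0 := by
        rw [List.map_append, List.prod_append] at h0
        simpa using right_ne_zero_of_mul h0
      rw [div_mul_eq_mul_div, div_le_iff₀ hκ0, mul_comm _ κ]
      refine le_trans ?_ (hbmul u [i])
      rw [mul_comm β]
      exact mul_le_mul (not_lt.1 hu) (hβ i hi) hβ0.le (hb u)
  refine ⟨_, ?_, (hquant P n).trans (ENNReal.ofReal_le_ofReal ?_)⟩
  · have h1 : (((stoppedWords P n []).filter fun w => (w.map p).prod ≠ 0).card : ℝ) *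
        (β / κ * ε) ^ (σ / (r + σ)) ≤ (((stoppedWords P n []).filter
          fun w => (w.map p).prod ≠ 0).map fun w => S.wordWeight p r w x₀ ^ (σ / (r + σ))).sum := by
      rw [← nsmul_eq_mul, ← Multiset.card_map (fun w => S.wordWeight p r w x₀ ^ (σ / (r + σ)))]
      refine Multiset.card_nsmul_le_sum fun y hy => ?_
      obtain ⟨w, hw, rfl⟩ := Multiset.mem_map.1 hy
      obtain ⟨hw1, hw2⟩ := Multiset.mem_filter.1 hw
      exact Real.rpow_le_rpow (by positivity) (hge w hw1 hw2) hq.le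
    have h2 : (((stoppedWords P n []).filter
        fun w => (w.map p).prod ≠ 0).map fun w => S.wordWeight p r w x₀ ^ (σ / (r + σ))).sum ≤
        ((stoppedWords P n []).map fun w => S.wordWeight p r w x₀ ^ (σ / (r + σ))).sum := by
      conv_rhs => rw [← Multiset.filter_add_not (fun w => (w.map p).prod ≠ 0)
        (stoppedWords P n []), Multiset.map_add, Multiset.sum_add]
      refine le_add_of_nonneg_right (Multiset.sum_nonneg fun y hy => ?_)
      obtain ⟨w, -, rfl⟩ := Multiset.mem_map.1 hy
      exact Real.rpow_nonneg (hb w) _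
    refine (h1.trans (h2.trans (hsum P n))).trans ?_
    exact le_mul_of_one_le_left (by positivity) (by linarith)
  · have h1 : ((stoppedWords P n []).map fun w => S.wordWeight p r w x₀).sum ≤
        ((stoppedWords P n []).map fun w =>
          S.wordWeight p r w x₀ ^ (σ / (r + σ)) * ε ^ (r / (r + σ))).sum := by
      refine Multiset.sum_map_le_sum_map _ _ fun w hw => ?_
      have hone : σ / (r + σ) + r / (r + σ) = 1 := by field_simp; ring
      calc S.wordWeight p r w x₀
          = S.wordWeight p r w x₀ ^ (σ / (r + σ)) * S.wordWeight p r w x₀ ^ (r / (r + σ)) := by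
            rw [← Real.rpow_add_of_nonneg (hb w) hq.le (by positivity), hone, Real.rpow_one]
        _ ≤ _ := mul_le_mul_of_nonneg_left
            (Real.rpow_le_rpow (hb w) (hlt w hw).le (by positivity)) (Real.rpow_nonneg (hb w) _)
    rw [Multiset.sum_map_mul_right] at h1
    have h2 := mul_le_mul_of_nonneg_right (hsum P n) (Real.rpow_nonneg hε.le (r / (r + σ)))
    calc d * _ ≤ d * (K ^ 3 * ε ^ (r / (r + σ))) :=
          mul_le_mul_of_nonneg_left (h1.trans h2) hd
      _ ≤ (d + 1) * (K ^ 3 * ε ^ (r / (r + σ))) :=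
          mul_le_mul_of_nonneg_right (by linarith) (by positivity)
      _ = _ := (mul_assoc _ _ _).symm

theorem exists_eventually_quantError_le [CompactSpace X] [PerfectSpace X] [MeasurableSpace X]
    [BorelSpace X] (S : InfSimilitudeIFS X N) (hinj : ∀ i, Function.Injective (S.f i)) {C : ℝ}
    (hC : 1 ≤ C) (hS : S.BoundedDistortion C) {p : Fin N → ℝ} (hp : ∀ i, 0 ≤ p i)
    (hp1 : ∑ i, p i = 1) {μ : Measure X} [IsProbabilityMeasure μ]
    (hμ : μ = ∑ i, ENNReal.ofReal (p i) • μ.map (S.f i)) {r σ : ℝ} (hr : 0 < r) (hσ : 0 < σ)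
    (hspr : spectralRadius ℂ (S.transferOp p hr hσ.le) = 1) :
    ∃ M : ℝ, 0 < M ∧ ∀ᶠ n : ℕ in atTop,
      quantError μ n r ≤ ENNReal.ofReal (M * (n : ℝ) ^ (-(r / σ))) := by
  obtain ⟨c, B, hc, hB, h⟩ := S.exists_quantError_le hinj hC hS hp hp1 hμ hr hσ hspr
  have hlim : Tendsto (fun n : ℕ => (B / n) ^ ((r + σ) / σ) / c) atTop (𝓝 0) := by
    have h1 : Tendsto (fun n : ℕ => B / (n : ℝ)) atTop (𝓝 0) :=
      tendsto_const_div_atTop_nhds_zero_nat B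
    have h2 := (h1.rpow_const (p := (r + σ) / σ) (Or.inr (by positivity))).div_const c
    rwa [Real.zero_rpow (by positivity), zero_div] at h2
  refine ⟨B * (B ^ (r / σ) / c ^ (r / (r + σ))), by positivity, ?_⟩
  filter_upwards [hlim.eventually_le_const one_pos, eventually_gt_atTop 0] with n hn1 hn
  have hn' : (0 : ℝ) < n := by exact_mod_cast hn
  -- Here `ε` solves `(c * ε) ^ (σ / (r + σ)) = B / n`, so the count bound becomes `k * (B / n) ≤
  -- B`, that is `k ≤ n`.
  obtain ⟨k, hk, hV⟩ := h _ (by positivity) hn1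
  have hkn : k ≤ n := by
    rw [mul_div_cancel₀ _ hc.ne', ← Real.rpow_mul (by positivity),
      show (r + σ) / σ * (σ / (r + σ)) = 1 by field_simp, Real.rpow_one, mul_div_assoc',
      div_le_iff₀ hn', mul_comm] at hk
    exact_mod_cast le_of_mul_le_mul_left hk hB
  refine ((quantError_anti μ r hkn).trans hV).trans_eq (congrArg _ ?_)
  rw [Real.div_rpow (by positivity) hc.le, ← Real.rpow_mul (by positivity),
    show (r + σ) / σ * (r / (r + σ)) = r / σ by field_simp, Real.div_rpow hB.le hn'.le,
    Real.rpow_neg hn'.le]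
  field_simp

/-- For `σ = 0` all exponents vanish, so the first level sum is `N` while its upper bound is `1`. -/
theorem pos_of_spectralRadius_eq_one [CompactSpace X] [PerfectSpace X] [Nonempty X] (hN : 2 ≤ N)
    (S : InfSimilitudeIFS X N) (hinj : ∀ i, Function.Injective (S.f i)) {C : ℝ} (hC : 1 ≤ C)
    (hS : S.BoundedDistortion C) {p : Fin N → ℝ} (hp : ∀ i, 0 ≤ p i) {r σ : ℝ} (hr : 0 < r)
    (hσ : 0 ≤ σ) (hspr : spectralRadius ℂ (S.transferOp p hr hσ) = 1) : 0 < σ := by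
  refine lt_of_le_of_ne hσ fun h0 => ?_
  obtain ⟨x₀⟩ := ‹Nonempty X›
  have h := (S.levelSum_bounds hinj hC hS hp hr hσ x₀ hspr 1).1
  simp only [← h0, levelSum, zero_div, Real.rpow_zero, Finset.sum_const, Finset.card_univ,
    Fintype.card_fin, nsmul_eq_mul, mul_one] at h
  have : N ≤ 1 := by exact_mod_cast h
  omega

end InfSimilitudeIFS

/-! ### From the power bound on the error to the coefficient and the dimension. -/

section Asymptotics

variable {X : Type*} [MetricSpace X] [MeasurableSpace X] {μ : Measure X} {r σ M : ℝ}

theorem limsup_mul_quantErrorRoot_lt_top (hr : 0 < r) (hσ : 0 < σ) (hM : 0 < M)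
    (h : ∀ᶠ n : ℕ in atTop, quantError μ n r ≤ ENNReal.ofReal (M * (n : ℝ) ^ (-(r / σ)))) :
    limsup (fun n : ℕ => (n : ℝ≥0∞) * quantErrorRoot μ n r ^ σ) atTop < ⊤ := by
  refine (limsup_le_of_le (a := ENNReal.ofReal (M ^ (σ / r))) (by isBoundedDefault) ?_).trans_lt
    ENNReal.ofReal_lt_top
  filter_upwards [h, eventually_gt_atTop 0] with n hn hn0
  have hn' : (0 : ℝ) < n := by exact_mod_cast hn0
  rw [quantErrorRoot, ← ENNReal.rpow_mul, one_div_mul_eq_div, ← ENNReal.ofReal_natCast]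
  calc ENNReal.ofReal n * quantError μ n r ^ (σ / r)
      ≤ ENNReal.ofReal n * ENNReal.ofReal (M * (n : ℝ) ^ (-(r / σ))) ^ (σ / r) := by gcongr
    _ = ENNReal.ofReal (M ^ (σ / r)) := by
      rw [ENNReal.ofReal_rpow_of_nonneg (by positivity) (by positivity),
        ← ENNReal.ofReal_mul hn'.le, Real.mul_rpow hM.le (by positivity), ← Real.rpow_mul hn'.le,
        show -(r / σ) * (σ / r) = -1 by field_simp, Real.rpow_neg_one]
      congr 1
      field_simp

theorem upperQuantDim_le (hr : 0 < r) (hσ : 0 < σ) (hM : 0 < M)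
    (h : ∀ᶠ n : ℕ in atTop, quantError μ n r ≤ ENNReal.ofReal (M * (n : ℝ) ^ (-(r / σ)))) :
    upperQuantDim μ r ≤ (σ : EReal) := by
  have hlog : Tendsto (fun n : ℕ => Real.log n) atTop atTop :=
    Real.tendsto_log_atTop.comp tendsto_natCast_atTop_atTop
  have hlim : Tendsto (fun n : ℕ => r / (r / σ - Real.log M / Real.log n)) atTop (𝓝 σ) := by
    have h1 := (tendsto_const_nhds (x := r / σ)).sub (hlog.const_div_atTop (Real.log M))
    have h2 := (tendsto_const_nhds (x := r)).div h1 (by rw [sub_zero]; positivity)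
    rwa [sub_zero, div_div_cancel₀ hr.ne'] at h2
  have hlim' : Tendsto (fun n : ℕ => ((r / (r / σ - Real.log M / Real.log n) : ℝ) : EReal)) atTop
      (𝓝 (σ : EReal)) := (continuous_coe_real_ereal.tendsto σ).comp hlim
  rw [← hlim'.limsup_eq]
  refine limsup_le_limsup ?_
  have hpos : ∀ᶠ n : ℕ in atTop, 0 < r / σ * Real.log n - Real.log M :=
    (tendsto_atTop_add_const_right _ (-Real.log M)
      (hlog.const_mul_atTop (show 0 < r / σ by positivity))).eventually_gt_atTop 0
  filter_upwards [h, hpos, hlog.eventually_gt_atTop 0, eventually_gt_atTop 0] with n hn hL hl hn0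
  have hn' : (0 : ℝ) < n := by exact_mod_cast hn0
  have hx : 0 < M * (n : ℝ) ^ (-(r / σ)) := by positivity
  have hle : ((r / σ * Real.log n - Real.log M : ℝ) : EReal) ≤ -ENNReal.log (quantError μ n r) := by
    rw [EReal.le_neg]
    refine (ENNReal.log_monotone hn).trans_eq ?_
    rw [ENNReal.log_ofReal_of_pos hx, Real.log_mul hM.ne' (by positivity), Real.log_rpow hn',
      ← EReal.coe_neg]
    congr 1
    ring
  -- Inversion is antitone on positive extended reals, including `⊤`, which covers a vanishing
  -- error.
  calc ((r * Real.log n : ℝ) : EReal) / (-ENNReal.log (quantError μ n r))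
      ≤ ((r * Real.log n : ℝ) : EReal) / ((r / σ * Real.log n - Real.log M : ℝ) : EReal) :=
        mul_le_mul_of_nonneg_left (EReal.inv_strictAntiOn.antitoneOn (EReal.coe_pos.2 hL)
          ((EReal.coe_pos.2 hL).trans_le hle) hle) (EReal.coe_nonneg.2 (by positivity))
    _ = _ := by
      rw [← EReal.coe_div, show r / σ * Real.log n - Real.log M =
        (r / σ - Real.log M / Real.log n) * Real.log n by field_simp,
        mul_div_mul_right _ _ hl.ne']

end Asymptotics

theorem mainTheorem3 {X : Type*} [MetricSpace X] [CompactSpace X] [PerfectSpace X]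
    [MeasurableSpace X] [BorelSpace X] {N : ℕ} (hN : 2 ≤ N)
    (S : InfSimilitudeIFS X N)
    (hS : ∃ C : ℝ, 0 < C ∧ ∀ w : List (Fin N), w ≠ [] → ∀ x y : X,
      infDeriv (S.wordMap w) x / C * dist x y ≤ dist (S.wordMap w x) (S.wordMap w y) ∧
      dist (S.wordMap w x) (S.wordMap w y) ≤ C * infDeriv (S.wordMap w) x * dist x y)
    (p : Fin N → ℝ) (hp : ∀ i, 0 ≤ p i) (hp1 : ∑ i, p i = 1)
    (μ : Measure X) [IsProbabilityMeasure μ]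
    (hμ : μ = ∑ i, ENNReal.ofReal (p i) • μ.map (S.f i))
    (r : ℝ) (hr : 0 < r) (σ : ℝ) (hσ : 0 ≤ σ)
    (hspr : spectralRadius ℂ (S.transferOp p hr hσ) = 1) :
    limsup (fun n : ℕ => (n : ℝ≥0∞) * quantErrorRoot μ n r ^ σ) atTop < ⊤ ∧
      upperQuantDim μ r ≤ (σ : EReal) := by
  obtain ⟨C, hC, hS⟩ := hS
  have hinj := S.injective_f hC fun w hw x y => (hS w hw x y).1
  have hS' := InfSimilitudeIFS.BoundedDistortion.of_ne_nil S hC hS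
  have hC' : 1 ≤ max C 1 := le_max_right _ _
  have : Nonempty X := nonempty_of_isProbabilityMeasure μ
  have hσ' : 0 < σ := S.pos_of_spectralRadius_eq_one hN hinj hC' hS' hp hr hσ hspr
  obtain ⟨M, hM, h⟩ :=
    S.exists_eventually_quantError_le hinj hC' hS' hp hp1 hμ hr hσ' hspr
  exact ⟨limsup_mul_quantErrorRoot_lt_top hr hσ' hM h, upperQuantDim_le hr hσ' hM h⟩
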